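/- Let $K$ be a field of any characteristic, let $n$ be a natural number, and let $H=(H_1,\ldots,H_n)\in K[x_1,\ldots,x_n]^n$ be a quadratic polynomial map in dimension $n$ over $K$, that is, $\deg H_i\le 2$ for every $i$. Let $JH=\big(\partial H_i/\partial x_j\big)_{i,j}$ be its Jacobian matrix, a matrix over $K[x_1,\ldots,x_n]$. If $JH$ is nilpotent and the rank of $JH$ (over the field $K(x_1,\ldots,x_n)$) is at most $2$, then $JH$ is similar over $K$ to a triangular matrix with only zeroes on the diagonal: there is a matrix $T\in \operatorname{GL}_n(K)$ such that $T^{-1}\cdot JH\cdot T$ is (upper or lower) triangular and all its diagonal entries are zero. -/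

import Mathlib

/-- The Jacobian matrix of the polynomial map `H = (H₁, …, Hₘ)` from `Kⁿ` to `Kᵐ`: the entry in
row `i` and column `j` is the (formal) partial derivative of `H i` with respect to `x j`. -/
noncomputable def jacobianMatrix {K : Type*} [Field K] {m n : ℕ}
    (H : Fin m → MvPolynomial (Fin n) K) :
    Matrix (Fin m) (Fin n) (MvPolynomial (Fin n) K) :=
  Matrix.of fun i j => MvPolynomial.pderiv j (H i)

/-- A polynomial map is quadratic if all its components have degree at most `2`. -/
def IsQuadraticMap {K : Type*} [Field K] {m n : ℕ}
    (H : Fin m → MvPolynomial (Fin n) K) : Prop :=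
  ∀ i, (H i).totalDegree ≤ 2

/-- The rank of a matrix of polynomials, i.e. its rank over the field `K(x₁, …, xₙ)` of
rational functions. -/
noncomputable def polyRank {K : Type*} [Field K] {k m n : ℕ}
    (M : Matrix (Fin m) (Fin k) (MvPolynomial (Fin n) K)) : ℕ :=
  (M.map (algebraMap (MvPolynomial (Fin n) K) (FractionRing (MvPolynomial (Fin n) K)))).rank

/-- Square matrices `M` and `M'` over a `K`-algebra `R` are similar over `K` if
`M' = T⁻¹ M T` for some invertible matrix `T` with entries in `K`. -/
def SimilarOver (K : Type*) [Field K] {R : Type*} [CommRing R] [Algebra K R] {n : ℕ}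
    (M M' : Matrix (Fin n) (Fin n) R) : Prop :=
  ∃ T : Matrix.GeneralLinearGroup (Fin n) K,
    M' = ((T⁻¹ : Matrix.GeneralLinearGroup (Fin n) K) : Matrix (Fin n) (Fin n) K).map
        (algebraMap K R) * M * (T : Matrix (Fin n) (Fin n) K).map (algebraMap K R)

/-- A square matrix is triangular if it is upper triangular or lower triangular. -/
def IsTriangularMatrix {R : Type*} [CommRing R] {n : ℕ} (M : Matrix (Fin n) (Fin n) R) : Prop :=
  M.IsUpperTriangular ∨ M.IsLowerTriangular

/-! As deg H ≤ 2, JH = A + Σ x_k A_k with constant matrices, and commuting partial derivatives give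
L x y = L y x for L x = Σ x_k A_k. Over an infinite extension E of K, every element s A + L x of the
`pencil` is nilpotent of rank at most 2. The heart is that such a pencil on a nonzero space has a
common kernel vector v (`exists_common_kernel`). Symmetry gives L v = 0, so the pencil descends to
the quotient by v, and induction shows that products of dim V elements vanish. For the coefficient
matrices this vanishing descends from E to K, where it yields a strictly triangular basis.

For the common kernel, take M of maximal rank. Comparing ranks along M + t N constrains every N
(`apply_mem_range_of_chain`); in particular N maps ker M into im M. In rank 2 this leaves four
cases: all images lie in im M (`exists_common_kernel_of_range_le`), a hyperplane is mapped into a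
line (`exists_common_kernel_of_hyperplane`), a kernel vector of M already works, or dim V = 3,
settled by an explicit matrix computation. -/

/-! ### Maximal rank along a line of endomorphisms -/

open Module in
/-- Linear independence is an open condition along a line. -/
theorem LinearIndependent.exists_ne_zero_add_smul {K V ι : Type*} [Field K] [Infinite K]
    [AddCommGroup V] [Module K V] [Fintype ι] {a : ι → V} (b : ι → V)
    (ha : LinearIndependent K a) : ∃ t : K, t ≠ 0 ∧ LinearIndependent K (a + t • b) := by
  classical
  obtain ⟨g, hg⟩ := (Fintype.linearCombination K a).exists_leftInverse_of_injective
    (LinearMap.ker_eq_bot.2 ha.fintypeLinearCombination_injective)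
  have hga (i : ι) : g (a i) = Pi.single i 1 := by
    have := LinearMap.congr_fun hg (Pi.single i 1)
    simpa [Fintype.linearCombination_apply_single] using this
  -- In the coordinates `g`, `a + t • b` has matrix 1 + t B, whose determinant is a polynomial in t
  -- with value 1 at 0. The factor X used below excludes t = 0.
  let p : Polynomial K :=
    (1 + (Polynomial.X : Polynomial K) • (Matrix.of fun i j => g (b i) j).map Polynomial.C).det
  have hp (t : K) : p.eval t = (1 + t • (Matrix.of fun i j => g (b i) j)).det := by
    rw [← Polynomial.coe_evalRingHom, RingHom.map_det]
    congr 1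
    ext i j
    by_cases h : i = j <;> simp [h, mul_comm t]
  have hp0 : p * Polynomial.X ≠ 0 := by
    refine mul_ne_zero (fun h => ?_) Polynomial.X_ne_zero
    have := hp 0
    simp [h] at this
  obtain ⟨t, ht⟩ : ∃ t, (p * Polynomial.X).eval t ≠ 0 := by
    by_contra! h
    exact hp0 (Polynomial.funext fun x => by simpa using h x)
  rw [Polynomial.eval_mul, Polynomial.eval_X, hp] at ht
  refine ⟨t, right_ne_zero_of_mul ht, LinearIndependent.of_comp g ?_⟩
  have := Matrix.linearIndependent_rows_of_det_ne_zero (left_ne_zero_of_mul ht)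
  have heq : g ∘ (a + t • b) = fun i => (1 + t • Matrix.of fun i j => g (b i) j) i := by
    ext i j
    simp [hga, Matrix.one_apply, Pi.single_apply, eq_comm]
  rw [heq]
  exact this

open Module in
/-- A chain starting in the kernel of a map `M` whose rank is maximal on the line `M + t N`
ends in the range of `M`. -/
theorem apply_mem_range_of_chain {K V : Type*} [Field K] [Infinite K]
    [AddCommGroup V] [Module K V] [FiniteDimensional K V] {M N : End K V}
    (hmax : ∀ t : K, finrank K (LinearMap.range (M + t • N)) ≤ finrank K (LinearMap.range M))
    {v₀ v₁ v₂ : V} (h₀ : M v₀ = 0) (h₁ : M v₁ = N v₀) (h₂ : M v₂ = N v₁) :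
    N v₂ ∈ LinearMap.range M := by
  by_contra hcon
  let e := finBasis K (LinearMap.range M)
  choose d hd using fun i => (e i).2
  have hli : LinearIndependent K (Fin.cons (N v₂) (fun i => M (d i)) : Fin _ → V) := by
    rw [linearIndependent_finCons]
    have : (fun i => M (d i)) = (LinearMap.range M).subtype ∘ e := by
      ext i; simp [hd]
    rw [this]
    refine ⟨e.linearIndependent.map' _ (Submodule.ker_subtype _), ?_⟩
    rwa [Set.range_comp, Submodule.span_image, e.span_eq, Submodule.map_top,
      Submodule.range_subtype]
  obtain ⟨t, ht, hli⟩ := hli.exists_ne_zero_add_smul (Fin.cons 0 fun i => N (d i))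
  have hmem (i) : ((Fin.cons (N v₂) (fun i => M (d i)) : Fin _ → V) +
      t • (Fin.cons 0 fun i => N (d i) : Fin _ → V)) i ∈ LinearMap.range (M + t • N) := by
    refine Fin.cases ?_ (fun i => ?_) i
    -- Telescoping: M + t N sends v₀ - t v₁ + t² v₂ to t³ N v₂. The range thus contains more
    -- independent vectors than the rank of M.
    · refine ⟨t⁻¹ ^ 3 • (v₀ - t • v₁ + t ^ 2 • v₂), ?_⟩
      simp only [LinearMap.add_apply, LinearMap.smul_apply, map_smul, map_add, map_sub, h₀, h₁,
        h₂, Pi.add_apply, Fin.cons_zero, Pi.smul_apply, smul_zero, add_zero]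
      match_scalars <;> field_simp <;> ring
    · exact ⟨d i, by simp⟩
  have hli' : LinearIndependent K (fun i => (⟨_, hmem i⟩ : LinearMap.range (M + t • N))) :=
    LinearIndependent.of_comp (LinearMap.range (M + t • N)).subtype hli
  have := hli'.fintype_card_le_finrank
  have := hmax t
  simp at *
  omega

/-! ### Small subspaces and single nilpotent maps -/

open Module in
theorem exists_eq_smul_add_smul {K V : Type*} [Field K] [AddCommGroup V] [Module K V]
    [FiniteDimensional K V] {I : Submodule K V} (hI : finrank K I ≤ 2) {u w y : V}
    (hu : u ∈ I) (hw : w ∈ I) (hy : y ∈ I) (hu0 : u ≠ 0) (hwu : ∀ c : K, w ≠ c • u) :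
    ∃ a b : K, y = a • u + b • w := by
  by_contra! hcon
  have hli : LinearIndependent K ![y, w, u] := by
    refine linearIndependent_finCons.2 ⟨linearIndependent_finCons.2
      ⟨linearIndependent_finCons.2 ⟨linearIndependent_empty_type, ?_⟩, ?_⟩, ?_⟩
    · simpa using hu0
    · intro h
      simp only [Matrix.range_cons, Matrix.range_empty, Set.union_empty] at h
      obtain ⟨c, hc⟩ := Submodule.mem_span_singleton.1 h
      exact hwu c hc.symm
    · intro h
      simp only [Matrix.range_cons, Matrix.range_empty, Set.union_empty, Set.singleton_union] at h
      obtain ⟨b, a, hab⟩ := Submodule.mem_span_pair.1 h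
      exact hcon a b (by rw [← hab, add_comm])
  have hmem : ∀ i, ![y, w, u] i ∈ I := by
    intro i; fin_cases i <;> simp [hu, hw, hy]
  have hli' : LinearIndependent K (fun i => (⟨_, hmem i⟩ : I)) :=
    LinearIndependent.of_comp I.subtype hli
  have := hli'.fintype_card_le_finrank
  simp at this
  omega

open Module in
theorem exists_eq_smul_of_finrank_le_one {K V : Type*} [Field K] [AddCommGroup V] [Module K V]
    [FiniteDimensional K V] {I : Submodule K V} (hI : finrank K I ≤ 1) {u y : V}
    (hu : u ∈ I) (hy : y ∈ I) (hu0 : u ≠ 0) : ∃ a : K, y = a • u := by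
  obtain ⟨v, hv⟩ := finrank_le_one_iff.1 hI
  obtain ⟨a, ha⟩ := hv ⟨u, hu⟩
  obtain ⟨b, hb⟩ := hv ⟨y, hy⟩
  have ha' : a • (v : V) = u := congrArg Subtype.val ha
  have hb' : b • (v : V) = y := congrArg Subtype.val hb
  have ha0 : a ≠ 0 := by rintro rfl; simp at ha'; exact hu0 ha'.symm
  refine ⟨b * a⁻¹, ?_⟩
  rw [← ha', ← hb', smul_smul, mul_assoc, inv_mul_cancel₀ ha0, mul_one]

theorem IsNilpotent.apply_eq_zero_of_eq_smul {K V : Type*} [Field K] [AddCommGroup V]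
    [Module K V] {N : Module.End K V} (hN : IsNilpotent N) {v : V} {c : K} (h : N v = c • v) :
    N v = 0 := by
  obtain ⟨k, hk⟩ := hN
  have hpow : ∀ k : ℕ, (N ^ k) v = c ^ k • v := by
    intro k
    induction k with
    | zero => simp
    | succ k ih => rw [_root_.pow_succ', Module.End.mul_apply, ih, map_smul, h, smul_smul,
        _root_.pow_succ]
  have := hpow k
  rw [hk, LinearMap.zero_apply, eq_comm, smul_eq_zero] at this
  rcases this with h0 | h0
  · rw [h, eq_zero_of_pow_eq_zero h0, zero_smul]
  · simp [h0]

/-- A nilpotent endomorphism squares to zero on a vector generating an invariant plane. -/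
theorem IsNilpotent.apply_apply_eq_zero {K V : Type*} [Field K] [AddCommGroup V]
    [Module K V] {N : Module.End K V} (hN : IsNilpotent N) {v : V} {a b : K}
    (h : N (N v) = a • v + b • N v) : N (N v) = 0 := by
  classical
  by_cases ha : a = 0
  · exact hN.apply_eq_zero_of_eq_smul (c := b) (by simpa [ha] using h)
  have hex : ∃ k, (N ^ k) v = 0 := by
    obtain ⟨k, hk⟩ := hN
    exact ⟨k, by simp [hk]⟩
  obtain ⟨hj, hmin⟩ := And.intro (Nat.find_spec hex) (fun m => Nat.find_min hex (m := m))
  generalize Nat.find hex = j at hj hmin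
  rcases j with _ | j
  · have : v = 0 := by simpa using hj
    simp [this]
  -- Applying N^j to the relation leaves a N^j v = 0, although j + 1 is the least exponent killing
  -- v.
  refine absurd ?_ (hmin j (by omega))
  have h1 : (N ^ j) (N v) = 0 := by
    rwa [_root_.pow_succ, Module.End.mul_apply] at hj
  have h2 : (N ^ j) (N (N v)) = 0 := by
    rw [← Module.End.mul_apply, ← _root_.pow_succ, _root_.pow_succ', Module.End.mul_apply, h1,
      map_zero]
  rw [h, map_add, map_smul, map_smul, h1, smul_zero, add_zero] at h2
  exact (smul_eq_zero.1 h2).resolve_left ha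

/-! ### Common kernel vectors of nilpotent spaces and symmetric pencils -/

open Module in
/-- A space of nilpotent endomorphisms with all images in a nonzero subspace of dimension at most
two has a common kernel vector. -/
theorem exists_common_kernel_of_range_le {K V : Type*} [Field K]
    [AddCommGroup V] [Module K V] [FiniteDimensional K V] {W : Submodule K (End K V)}
    (hnil : ∀ N ∈ W, IsNilpotent N) {I : Submodule K V} (hI : finrank K I ≤ 2) (hI0 : I ≠ ⊥)
    (hW : ∀ N ∈ W, ∀ x, N x ∈ I) : ∃ v ≠ 0, ∀ N ∈ W, N v = 0 := by
  by_cases hall : ∀ N ∈ W, ∀ x ∈ I, N x = 0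
  · obtain ⟨v, hv, hv0⟩ := Submodule.exists_mem_ne_zero_of_ne_bot hI0
    exact ⟨v, hv0, fun N hN => hall N hN v hv⟩
  push Not at hall
  obtain ⟨N₀, hN₀, w, hw, hu0⟩ := hall
  have hsq : ∀ N ∈ W, ∀ x ∈ I, N (N x) = 0 := by
    intro N hN x hx
    by_cases hx0 : x = 0
    · simp [hx0]
    by_cases h : ∀ c : K, N x ≠ c • x
    · obtain ⟨a, b, hab⟩ := exists_eq_smul_add_smul hI hx (hW N hN x) (hW N hN (N x)) hx0 h
      exact (hnil N hN).apply_apply_eq_zero hab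
    · push Not at h
      obtain ⟨c, hc⟩ := h
      rw [(hnil N hN).apply_eq_zero_of_eq_smul hc, map_zero]
  refine ⟨N₀ w, hu0, fun N hN => ?_⟩
  have hwu : ∀ c : K, w ≠ c • N₀ w := by
    intro c hc
    apply hu0
    nth_rw 1 [hc]
    rw [map_smul, hsq N₀ hN₀ w hw, smul_zero]
  obtain ⟨a, b, hab⟩ := exists_eq_smul_add_smul hI (hW N₀ hN₀ w) hw (hW N hN w) hu0 hwu
  -- Polarising N² = 0 at w gives N N₀ w = -N₀ N w = -b N₀ w, so N₀ w is an eigenvector of N.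
  have h1 := hsq (N₀ + N) (W.add_mem hN₀ hN) w hw
  have h2 : N (N₀ w) + N₀ (N w) = 0 := by
    simpa [hsq N₀ hN₀ w hw, hsq N hN w hw, add_comm] using h1
  refine (hnil N hN).apply_eq_zero_of_eq_smul (c := -b) ?_
  rw [eq_neg_of_add_eq_zero_left h2, hab, map_add, map_smul, map_smul, hsq N₀ hN₀ w hw]
  simp

open Module in
/-- The linear span of the values of the affine linear family `A + L x`. -/
def pencil {K V : Type*} [Field K] [AddCommGroup V] [Module K V] (A : End K V)
    (L : V →ₗ[K] End K V) : Submodule K (End K V) :=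
  Submodule.span K {A} ⊔ LinearMap.range L

open Module in
theorem mem_pencil {K V : Type*} [Field K] [AddCommGroup V] [Module K V] {A : End K V}
    {L : V →ₗ[K] End K V} {N : End K V} :
    N ∈ pencil A L ↔ ∃ (s : K) (x : V), N = s • A + L x := by
  simp only [pencil, Submodule.mem_sup, Submodule.mem_span_singleton, LinearMap.mem_range]
  constructor
  · rintro ⟨_, ⟨s, rfl⟩, _, ⟨x, rfl⟩, rfl⟩
    exact ⟨s, x, rfl⟩
  · rintro ⟨s, x, rfl⟩
    exact ⟨_, ⟨s, rfl⟩, _, ⟨x, rfl⟩, rfl⟩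

open Module in
theorem mem_pencil_left {K V : Type*} [Field K] [AddCommGroup V] [Module K V] (A : End K V)
    (L : V →ₗ[K] End K V) : A ∈ pencil A L :=
  mem_pencil.2 ⟨1, 0, by simp⟩

open Module in
theorem mem_pencil_right {K V : Type*} [Field K] [AddCommGroup V] [Module K V] (A : End K V)
    (L : V →ₗ[K] End K V) (x : V) : L x ∈ pencil A L :=
  mem_pencil.2 ⟨0, x, by simp⟩

open Module in
/-- If a symmetric nilpotent pencil maps a hyperplane into a line, then it has a common kernel
vector. -/
theorem exists_common_kernel_of_hyperplane {K V : Type*} [Field K]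
    [AddCommGroup V] [Module K V] {A : End K V} {L : V →ₗ[K] End K V}
    (hsymm : ∀ x y, L x y = L y x) (hnil : ∀ N ∈ pencil A L, IsNilpotent N)
    {U : Submodule K V} (hU : ∀ y ∉ U, ∀ x, ∃ c : K, x - c • y ∈ U) {e : V} (he : e ≠ 0)
    (hW : ∀ N ∈ pencil A L, ∀ x ∈ U, ∃ c : K, N x = c • e) :
    ∃ v ≠ 0, ∀ N ∈ pencil A L, N v = 0 := by
  by_cases heU : e ∈ U
  · refine ⟨e, he, fun N hN => ?_⟩
    obtain ⟨c, hc⟩ := hW N hN e heU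
    exact (hnil N hN).apply_eq_zero_of_eq_smul hc
  -- Write N e = c e + u with u ∈ U. Then N² e lies in the span of e and N e, hence vanishes; c ≠ 0
  -- would make e an eigenvector.
  have hsq : ∀ N ∈ pencil A L, N (N e) = 0 ∧ N e ∈ U := by
    intro N hN
    obtain ⟨c, hc⟩ := hU e heU (N e)
    obtain ⟨f, hf⟩ := hW N hN _ hc
    have h1 : N (N e) = f • e + c • N e := by
      rw [map_sub, map_smul, sub_eq_iff_eq_add] at hf
      exact hf
    have h2 := (hnil N hN).apply_apply_eq_zero h1
    refine ⟨h2, ?_⟩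
    by_cases hc0 : c = 0
    · simpa [hc0] using hc
    · have : N e = (-(c⁻¹ * f)) • e := by
        rw [h2] at h1
        have h3 := congrArg (c⁻¹ • ·) h1
        simp only [smul_add, smul_smul, smul_zero, inv_mul_cancel₀ hc0, one_smul] at h3
        rw [neg_smul]
        exact eq_neg_of_add_eq_zero_right h3.symm
      rw [(hnil N hN).apply_eq_zero_of_eq_smul this]
      exact U.zero_mem
  have hpol : ∀ N ∈ pencil A L, ∀ N' ∈ pencil A L, N (N' e) + N' (N e) = 0 := by
    intro N hN N' hN'
    have := (hsq (N + N') (Submodule.add_mem _ hN hN')).1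
    simpa [(hsq N hN).1, (hsq N' hN').1, add_comm] using this
  have hA := mem_pencil_left A L
  have hL := mem_pencil_right A L
  -- L u e = L e u lies both on the line of e and in U, which meet only in 0.
  have hLe : ∀ u ∈ U, L u e = 0 := by
    intro u hu
    obtain ⟨c, hc⟩ := hW (L e) (hL e) u hu
    rw [hsymm e u] at hc
    by_contra h0
    have hc0 : c ≠ 0 := by rintro rfl; simp [h0] at hc
    have := (hsq (L u) (hL u)).2
    rw [hc] at this
    exact heU ((U.smul_mem_iff hc0).1 this)
  have hdec : ∀ v, A v = 0 → L e v = 0 → (∀ u ∈ U, L u v = 0) →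
      ∀ N ∈ pencil A L, N v = 0 := by
    intro v h1 h2 h3 N hN
    obtain ⟨s, x, rfl⟩ := mem_pencil.1 hN
    obtain ⟨c, hc⟩ := hU e heU x
    have h4 := h3 _ hc
    rw [map_sub, map_smul, LinearMap.sub_apply, LinearMap.smul_apply, h2, smul_zero,
      sub_zero] at h4
    simp [h1, h4]
  have hLe0 : ∀ u ∈ U, L e u = 0 := fun u hu => by rw [hsymm, hLe u hu]
  -- The kernel vector is the first nonzero one among A e, L e e and e.
  by_cases h0 : A e = 0
  · by_cases h1 : L e e = 0
    · exact ⟨e, he, hdec e h0 h1 hLe⟩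
    · refine ⟨L e e, h1, hdec _ ?_ (hsq _ (hL e)).1 ?_⟩
      · simpa [h0] using hpol A hA (L e) (hL e)
      · intro u hu
        simpa [hLe u hu] using hpol (L u) (hL u) (L e) (hL e)
  · refine ⟨A e, h0, hdec _ (hsq A hA).1 (hLe0 _ (hsq A hA).2) ?_⟩
    intro u hu
    simpa [hLe u hu] using hpol (L u) (hL u) A hA

/-! ### Dimension three -/

/-- The coefficients of the characteristic polynomial of a nilpotent `3 × 3` matrix vanish. -/
theorem Matrix.coeffs_eq_zero_of_isNilpotent_fin_three {K : Type*} [Field K]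
    {N : Matrix (Fin 3) (Fin 3) K} (hN : IsNilpotent N) :
    N 0 0 + N 1 1 + N 2 2 = 0 ∧
    N 0 0 * N 1 1 - N 0 1 * N 1 0 + N 0 0 * N 2 2 - N 0 2 * N 2 0 + N 1 1 * N 2 2
      - N 1 2 * N 2 1 = 0 ∧ N.det = 0 := by
  have htr := (Matrix.isNilpotent_trace_of_isNilpotent hN).eq_zero
  have hcp := (Matrix.isNilpotent_charpoly_sub_pow_of_isNilpotent hN).eq_zero
  have hev (t : K) : (Matrix.scalar (Fin 3) t - N).det = t ^ 3 := by
    rw [← Matrix.eval_charpoly, sub_eq_zero.1 hcp]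
    simp
  have hdet : N.det = 0 := by
    obtain ⟨k, hk⟩ := hN
    refine eq_zero_of_pow_eq_zero (n := k) ?_
    rw [← Matrix.det_pow, hk, Matrix.det_zero]
  have h1 := hev 1
  rw [Matrix.trace_fin_three] at htr
  refine ⟨htr, ?_, hdet⟩
  rw [Matrix.det_fin_three] at h1 hdet
  simp at h1
  linear_combination h1 + hdet + htr

/-- A linear space of nilpotent `3 × 3` matrices containing the regular nilpotent Jordan block
either consists of matrices with vanishing first column, or is a plane of a specific shape. -/
theorem Matrix.nilpotent_space_fin_three {K : Type*} [Field K] [Infinite K]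
    {W : Submodule K (Matrix (Fin 3) (Fin 3) K)} (hnil : ∀ N ∈ W, IsNilpotent N)
    (hJ : !![0, 1, 0; 0, 0, 1; 0, 0, 0] ∈ W) :
    (∀ N ∈ W, ∀ i, N i 0 = 0) ∨ ∃ p u : K,
      !![p, u, p ^ 3; 1, -2 * p, u + 3 * p ^ 2; 0, -1, p] ∈ W ∧
      ∀ X ∈ W, ∃ a b : K, X = a • !![0, 1, 0; 0, 0, 1; 0, 0, 0] +
        b • !![p, u, p ^ 3; 1, -2 * p, u + 3 * p ^ 2; 0, -1, p] := by
  -- With J the Jordan block, s ↦ det(N + s J) is at most quadratic with s²-coefficient `N 2 0`, and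
  -- vanishes at the distinct points 0, 1, t.
  obtain ⟨t, ht⟩ : ∃ t : K, t ^ 2 - t ≠ 0 := by
    classical
    obtain ⟨t, ht⟩ := Infinite.exists_notMem_finset ({0, 1} : Finset K)
    simp only [Finset.mem_insert, Finset.mem_singleton, not_or] at ht
    refine ⟨t, fun h => ?_⟩
    have : t * (t - 1) = 0 := by linear_combination h
    rcases mul_eq_zero.1 this with h | h
    · exact ht.1 h
    · exact ht.2 (sub_eq_zero.1 h)
  -- consequences of the nilpotency of `N + s J`
  have hlow : ∀ N ∈ W, N 2 0 = 0 ∧ N 2 1 = -N 1 0 ∧ N 1 1 = - N 0 0 - N 2 2 ∧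
      N 0 0 * N 1 1 + N 0 0 * N 2 2 + N 1 1 * N 2 2 + N 1 0 * (N 1 2 - N 0 1) = 0 ∧
      N 1 0 * (N 0 0 - N 2 2) = 0 ∧
      N 0 0 * N 1 1 * N 2 2 + N 1 0 * (N 0 0 * N 1 2 - N 0 1 * N 2 2 - N 0 2 * N 1 0) = 0 := by
    intro N hN
    obtain ⟨a1, a2, a3⟩ := Matrix.coeffs_eq_zero_of_isNilpotent_fin_three (hnil N hN)
    obtain ⟨-, b2, b3⟩ := Matrix.coeffs_eq_zero_of_isNilpotent_fin_three
      (hnil _ (W.add_mem hN hJ))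
    obtain ⟨-, -, c3⟩ := Matrix.coeffs_eq_zero_of_isNilpotent_fin_three
      (hnil _ (W.add_mem hN (W.smul_mem t hJ)))
    rw [Matrix.det_fin_three] at a3 b3 c3
    simp at b2 b3 c3
    have e20 : N 2 0 = 0 := by
      have : (t ^ 2 - t) * N 2 0 = 0 := by linear_combination c3 - t * b3 - (1 - t) * a3
      exact (mul_eq_zero.1 this).resolve_left ht
    have e21 : N 2 1 = - N 1 0 := by linear_combination a2 - b2
    rw [e20, e21] at a3 b3
    rw [e20, e21] at a2
    refine ⟨e20, e21, ?_, ?_, ?_, ?_⟩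
    · linear_combination a1
    · linear_combination a2
    · linear_combination b3 - a3
    · linear_combination a3
  by_cases hall : ∀ N ∈ W, N 1 0 = 0
  · left
    intro N hN i
    obtain ⟨e20, -, e11, e2, -, e3⟩ := hlow N hN
    have e10 := hall N hN
    fin_cases i
    · show N 0 0 = 0
      rw [e10, e11] at e2 e3
      have : N 0 0 ^ 3 = 0 := by linear_combination N 0 0 * (- e2) + e3
      exact eq_zero_of_pow_eq_zero this
    · exact e10
    · exact e20
  right
  push Not at hall
  obtain ⟨N', hN', hq⟩ := hall
  have hone : ∀ X ∈ W, X 1 0 = 1 → X = !![X 0 0, X 0 1, X 0 0 ^ 3; 1, -2 * X 0 0,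
      X 0 1 + 3 * X 0 0 ^ 2; 0, -1, X 0 0] := by
    intro X hX hX1
    obtain ⟨e20, e21, e11, e2, e00, e3⟩ := hlow X hX
    rw [hX1] at e21 e2 e00 e3
    have f22 : X 2 2 = X 0 0 := by linear_combination -e00
    have f11 : X 1 1 = -2 * X 0 0 := by linear_combination e11 - f22
    have f12 : X 1 2 = X 0 1 + 3 * X 0 0 ^ 2 := by
      rw [f22, f11] at e2; linear_combination e2
    have f02 : X 0 2 = X 0 0 ^ 3 := by
      rw [f22, f11, f12] at e3; linear_combination -e3
    ext i j
    fin_cases i <;> fin_cases j <;> simp [e20, e21, f22, f11, f12, f02, hX1]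
  have hzero : ∀ X ∈ W, X 1 0 = 0 → X 0 0 = 0 := by
    intro X hX hX1
    obtain ⟨e20, e21, e11, e2, e00, e3⟩ := hlow X hX
    rw [hX1, e11] at e2 e3
    have : X 0 0 ^ 3 = 0 := by linear_combination X 0 0 * (- e2) + e3
    exact eq_zero_of_pow_eq_zero this
  obtain ⟨N, hN, hN1⟩ : ∃ N ∈ W, N 1 0 = 1 :=
    ⟨(N' 1 0)⁻¹ • N', W.smul_mem _ hN', by simp [hq]⟩
  have hNeq := hone N hN hN1
  refine ⟨N 0 0, N 0 1, hNeq ▸ hN, fun X hX => ⟨X 0 1 - X 1 0 * N 0 1, X 1 0, ?_⟩⟩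
  rw [← hNeq]
  -- the element with lower left part of `N` congruent to `X`
  have hY : X - X 1 0 • N ∈ W := W.sub_mem hX (W.smul_mem _ hN)
  have hY0 : (X - X 1 0 • N) 0 0 = 0 := hzero _ hY (by simp [hN1])
  -- N and N + (X - X₁₀ N) share the parameter p, so they differ only in u; changing u adds a
  -- multiple of J.
  have hZ := hone (N + (X - X 1 0 • N)) (W.add_mem hN hY) (by simp [hN1])
  have hZ0 : (N + (X - X 1 0 • N)) 0 0 = N 0 0 := by
    rw [Matrix.add_apply, hY0, add_zero]
  rw [hZ0] at hZ
  have : X = !![N 0 0, (N + (X - X 1 0 • N)) 0 1, N 0 0 ^ 3; 1, -2 * N 0 0,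
      (N + (X - X 1 0 • N)) 0 1 + 3 * N 0 0 ^ 2; 0, -1, N 0 0] - N + X 1 0 • N := by
    rw [← hZ]; abel
  nth_rw 1 [this]
  ext i j
  have hNij := congrFun (congrFun hNeq i) j
  fin_cases i <;> fin_cases j <;> simp at hNij ⊢ <;> simp [hNij]

/-- Nonzero matrices in the exceptional nilpotent plane have a kernel of dimension one. -/
theorem Matrix.kernel_of_exceptional_plane {K : Type*} [Field K] {p u a b : K}
    {D : Matrix (Fin 3) (Fin 3) K}
    (hD : D = a • !![0, 1, 0; 0, 0, 1; 0, 0, 0] +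
      b • !![p, u, p ^ 3; 1, -2 * p, u + 3 * p ^ 2; 0, -1, p]) (hD0 : D ≠ 0)
    {x y : Fin 3 → K} (hx : D.mulVec x = 0) (hy : D.mulVec y = 0) (hx0 : x ≠ 0) :
    ∃ c : K, y = c • x := by
  have hrow : ∀ z : Fin 3 → K, D.mulVec z = 0 →
      (b * p * z 0 + (a + b * u) * z 1 + b * p ^ 3 * z 2 = 0) ∧
      (b * z 0 - 2 * b * p * z 1 + (a + b * (u + 3 * p ^ 2)) * z 2 = 0) ∧
      (b * (- z 1 + p * z 2) = 0) := by
    intro z hz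
    have h0 := congrFun hz 0
    have h1 := congrFun hz 1
    have h2 := congrFun hz 2
    simp [hD, Matrix.mulVec, dotProduct, Fin.sum_univ_three] at h0 h1 h2
    refine ⟨?_, ?_, ?_⟩
    · linear_combination h0
    · linear_combination h1
    · linear_combination h2
  obtain ⟨x0, x1, x2⟩ := hrow x hx
  obtain ⟨y0, y1, y2⟩ := hrow y hy
  by_cases hb : b = 0
  · have ha : a ≠ 0 := by
      rintro rfl
      apply hD0
      simp [hD, hb]
    simp [hb, ha] at x0 x1 y0 y1
    have hx00 : x 0 ≠ 0 := by
      intro h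
      apply hx0
      ext i; fin_cases i <;> simp [h, x0, x1]
    refine ⟨y 0 / x 0, ?_⟩
    ext i; fin_cases i <;> simp [x0, x1, y0, y1, hx00]
  · have ex1 : x 1 = p * x 2 := by linear_combination -(mul_eq_zero.1 x2).resolve_left hb
    have ey1 : y 1 = p * y 2 := by linear_combination -(mul_eq_zero.1 y2).resolve_left hb
    have ex0 : x 0 = (2 * p ^ 2 - a / b - (u + 3 * p ^ 2)) * x 2 := by
      rw [ex1] at x1; field_simp; linear_combination x1
    have ey0 : y 0 = (2 * p ^ 2 - a / b - (u + 3 * p ^ 2)) * y 2 := by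
      rw [ey1] at y1; field_simp; linear_combination y1
    have hx20 : x 2 ≠ 0 := by
      intro h
      apply hx0
      ext i; fin_cases i <;> simp [h, ex0, ex1]
    refine ⟨y 2 / x 2, ?_⟩
    ext i; fin_cases i
    · simp only [Fin.zero_eta, Pi.smul_apply, smul_eq_mul, ex0, ey0]; field_simp
    · simp only [Fin.mk_one, Pi.smul_apply, smul_eq_mul, ex1, ey1]; field_simp
    · simp [hx20]

open Module in
/-- A symmetric nilpotent pencil in dimension three containing a map of rank two has a common
kernel vector. -/
theorem exists_common_kernel_of_finrank_eq_three {K V : Type*} [Field K] [Infinite K]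
    [AddCommGroup V] [Module K V] [FiniteDimensional K V] (hV : finrank K V = 3)
    {A : End K V} {L : V →ₗ[K] End K V}
    (hsymm : ∀ x y, L x y = L y x) (hnil : ∀ N ∈ pencil A L, IsNilpotent N)
    {M : End K V} (hM : M ∈ pencil A L) (hM2 : finrank K (LinearMap.range M) = 2) :
    ∃ v ≠ 0, ∀ N ∈ pencil A L, N v = 0 := by
  have hM3 : ∀ x, M (M (M x)) = 0 := by
    intro x
    have h1 := M.aeval_self_charpoly
    rw [(hnil M hM).charpoly_eq_X_pow_finrank, hV] at h1
    have h2 := LinearMap.congr_fun h1 x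
    simpa [pow_succ] using h2
  -- Otherwise im M, of dimension 2, would lie in ker M, of dimension 1.
  obtain ⟨w, hw⟩ : ∃ w, M (M w) ≠ 0 := by
    by_contra! h
    have h1 : LinearMap.range M ≤ LinearMap.ker M := by
      rintro _ ⟨x, rfl⟩
      exact h x
    have h2 := Submodule.finrank_mono h1
    have h3 := M.finrank_range_add_finrank_ker
    omega
  have hli : LinearIndependent K ![M (M w), M w, w] := by
    rw [Fintype.linearIndependent_iff]
    intro g hg
    simp only [Fin.sum_univ_three, Matrix.cons_val] at hg
    have g2 : g 2 = 0 := by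
      have h := congrArg (fun z => M (M z)) hg
      simpa [hM3, hw] using h
    have g1 : g 1 = 0 := by
      have h := congrArg (fun z => M z) hg
      simpa [hM3, hw, g2] using h
    have g0 : g 0 = 0 := by simpa [g1, g2, hw] using hg
    intro i; fin_cases i <;> assumption
  let B := basisOfLinearIndependentOfCardEqFinrank hli (by simp [hV])
  have hB0 : B 0 = M (M w) := by simp [B]
  have hB1 : B 1 = M w := by simp [B]
  have hB2 : B 2 = w := by simp [B]
  let e := LinearMap.toMatrixAlgEquiv B
  have he (N : End K V) (i j) : e N i j = B.repr (N (B j)) i := LinearMap.toMatrixAlgEquiv_apply ..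
  have hmul (N : End K V) (x : V) : (e N).mulVec (B.repr x) = B.repr (N x) :=
    LinearMap.toMatrix_mulVec_repr B B N x
  have heM : e M = !![0, 1, 0; 0, 0, 1; 0, 0, 0] := by
    have h0 : M (B 0) = 0 := by rw [hB0, hM3]
    have h1 : M (B 1) = B 0 := by rw [hB0, hB1]
    have h2 : M (B 2) = B 1 := by rw [hB1, hB2]
    ext i j
    rw [he]
    fin_cases j <;> fin_cases i <;> simp [h0, h1, h2]
  rcases Matrix.nilpotent_space_fin_three (W := (pencil A L).map e.toLinearMap)
    (by rintro _ ⟨N, hN, rfl⟩; exact (hnil N hN).map e) ⟨M, hM, heM⟩ with h | ⟨p, u, hN', hspan⟩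
  · refine ⟨B 0, B.ne_zero 0, fun N hN => B.repr.map_eq_zero_iff.1 ?_⟩
    ext i
    rw [← he]
    exact h _ ⟨N, hN, rfl⟩ i
  obtain ⟨N₀, hN₀, heN₀⟩ := hN'
  change e N₀ = _ at heN₀
  have hspan' : ∀ D ∈ pencil A L, ∃ a b : K, D = a • M + b • N₀ := by
    intro D hD
    obtain ⟨a, b, hab⟩ := hspan (e D) ⟨D, hD, rfl⟩
    refine ⟨a, b, e.injective ?_⟩
    rw [hab, map_add, map_smul, map_smul, heM, heN₀]
  have hker : ∀ D ∈ pencil A L, D ≠ 0 → ∀ x y, D x = 0 → D y = 0 → x ≠ 0 →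
      ∃ c : K, y = c • x := by
    intro D hD hD0 x y hx hy hx0
    obtain ⟨a, b, hab⟩ := hspan (e D) ⟨D, hD, rfl⟩
    obtain ⟨c, hc⟩ := Matrix.kernel_of_exceptional_plane (x := B.repr x) (y := B.repr y) hab
      (by simpa using hD0) (by rw [hmul, hx]; simp) (by rw [hmul, hy]; simp)
      (by
        intro h
        apply hx0
        apply B.repr.map_eq_zero_iff.1
        ext i; exact congrFun h i)
    refine ⟨c, B.repr.injective ?_⟩
    ext i
    simpa using congrFun hc i
  by_cases hL : L = 0
  · obtain ⟨v, hv, hv0⟩ : ∃ v, A v = 0 ∧ v ≠ 0 := by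
      by_contra! h
      obtain ⟨k, hk⟩ := hnil A (mem_pencil_left A L)
      have hinj : Function.Injective A := (injective_iff_map_eq_zero A).2 h
      have hinjk : Function.Injective (A ^ k) := by
        rw [Module.End.coe_pow]; exact hinj.iterate k
      rw [hk] at hinjk
      exact hw (hinjk (by simp))
    refine ⟨v, hv0, fun N hN => ?_⟩
    obtain ⟨s, x, rfl⟩ := mem_pencil.1 hN
    simp [hL, hv]
  -- The exceptional plane forces L = 0. By symmetry ker L lies in the one-dimensional kernel of
  -- some L x₀, so L maps onto the pencil and a nonzero v in ker L is killed by every element. But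
  -- ker M is spanned by B 0, and N₀ does not kill B 0.
  exfalso
  have hW2 : finrank K (pencil A L) ≤ 2 := by
    classical
    have : pencil A L ≤ Submodule.span K (({M, N₀} : Finset (End K V)) : Set (End K V)) := by
      intro D hD
      obtain ⟨a, b, rfl⟩ := hspan' D hD
      rw [Finset.coe_insert, Finset.coe_singleton]
      exact Submodule.mem_span_pair.2 ⟨a, b, rfl⟩
    exact (Submodule.finrank_mono this).trans ((finrank_span_finset_le_card _).trans
      Finset.card_le_two)
  have hle : LinearMap.range L ≤ pencil A L := by
    rintro _ ⟨x, rfl⟩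
    exact mem_pencil_right A L x
  have hsum := L.finrank_range_add_finrank_ker
  have hr2 := Submodule.finrank_mono hle
  have hkpos : LinearMap.ker L ≠ ⊥ := by
    intro h
    rw [h, finrank_bot] at hsum
    omega
  obtain ⟨v, hv, hv0⟩ := Submodule.exists_mem_ne_zero_of_ne_bot hkpos
  rw [LinearMap.mem_ker] at hv
  obtain ⟨x₀, hx₀⟩ : ∃ x, L x ≠ 0 := by
    by_contra! h
    exact hL (LinearMap.ext h)
  have hk1 : finrank K (LinearMap.ker L) ≤ 1 := by
    refine finrank_le_one ⟨v, hv⟩ fun y => ?_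
    obtain ⟨c, hc⟩ := hker (L x₀) (mem_pencil_right A L x₀) hx₀ v y
      (by rw [hsymm, hv]; rfl) (by rw [hsymm, LinearMap.mem_ker.1 y.2]; rfl) hv0
    exact ⟨c, Subtype.ext hc.symm⟩
  have heq : LinearMap.range L = pencil A L :=
    Submodule.eq_of_le_of_finrank_le hle (by omega)
  have hvan : ∀ N ∈ pencil A L, N v = 0 := by
    intro N hN
    rw [← heq] at hN
    obtain ⟨x, rfl⟩ := hN
    rw [hsymm, hv]; rfl
  have hMb : M (B 0) = 0 := by rw [hB0, hM3]
  obtain ⟨c, hc⟩ := hker M hM (by rintro rfl; simp at hw) v (B 0) (hvan M hM) hMb hv0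
  have h1 : N₀ (B 0) = 0 := by rw [hc, map_smul, hvan N₀ hN₀, smul_zero]
  have h2 := he N₀ 1 0
  rw [h1, heN₀] at h2
  simp at h2

/-! ### Common kernel vectors in rank at most two -/

open Module in
/-- A symmetric nilpotent pencil of maximal rank two has a common kernel vector. -/
theorem exists_common_kernel_of_rank_two {K V : Type*} [Field K] [Infinite K]
    [AddCommGroup V] [Module K V] [FiniteDimensional K V]
    {A : End K V} {L : V →ₗ[K] End K V}
    (hsymm : ∀ x y, L x y = L y x) (hnil : ∀ N ∈ pencil A L, IsNilpotent N)
    {M : End K V} (hM : M ∈ pencil A L) (hM2 : finrank K (LinearMap.range M) = 2)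
    (hmax : ∀ N ∈ pencil A L, finrank K (LinearMap.range N) ≤ 2) :
    ∃ v ≠ 0, ∀ N ∈ pencil A L, N v = 0 := by
  have chain : ∀ N ∈ pencil A L, ∀ v₀ v₁ v₂ : V, M v₀ = 0 → M v₁ = N v₀ → M v₂ = N v₁ →
      N v₂ ∈ LinearMap.range M := by
    intro N hN v₀ v₁ v₂ h₀ h₁ h₂
    refine apply_mem_range_of_chain (fun t => ?_) h₀ h₁ h₂
    rw [hM2]
    exact hmax _ (Submodule.add_mem _ hM (Submodule.smul_mem _ _ hN))
  have chain0 : ∀ N ∈ pencil A L, ∀ v, M v = 0 → N v ∈ LinearMap.range M := fun N hN v hv =>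
    chain N hN 0 0 v (map_zero M) (by simp) (by simp [hv])
  have chain1 : ∀ N ∈ pencil A L, ∀ v d, M v = 0 → M d = N v → N d ∈ LinearMap.range M :=
    fun N hN v d hv hd => chain N hN 0 v d (map_zero M) (by simp [hv]) hd
  have plane {u w y : V} (hu : u ∈ LinearMap.range M) (hw : w ∈ LinearMap.range M)
      (hy : y ∈ LinearMap.range M) (hu0 : u ≠ 0) (hwu : ∀ c : K, w ≠ c • u) :
      ∃ a b : K, y = a • u + b • w := exists_eq_smul_add_smul hM2.le hu hw hy hu0 hwu
  obtain ⟨v₁, hv₁, hv₁0⟩ : ∃ v, M v = 0 ∧ v ≠ 0 := by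
    by_contra! h
    obtain ⟨k, hk⟩ := hnil M hM
    have hinj : Function.Injective M := (injective_iff_map_eq_zero M).2 h
    have hinjk : Function.Injective (M ^ k) := by
      rw [Module.End.coe_pow]; exact hinj.iterate k
    have hsub : Subsingleton V := ⟨fun x y => hinjk (by simp [hk])⟩
    have := finrank_zero_of_subsingleton (R := K) (M := LinearMap.range M)
    omega
  by_cases hb : ∀ N ∈ pencil A L, ∀ v, M v = 0 → N v = 0
  · exact ⟨v₁, hv₁0, fun N hN => hb N hN v₁ hv₁⟩
  by_cases hc : ∀ N ∈ pencil A L, ∀ y, N y ∈ LinearMap.range M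
  · refine exists_common_kernel_of_range_le hnil hM2.le (fun h => ?_) hc
    rw [h, finrank_bot] at hM2
    omega
  -- an element which is nonzero on the kernel of `M` and leaves the range of `M`
  obtain ⟨N, hN, v₀, hv₀, hβ, y₀, hy₀⟩ : ∃ N ∈ pencil A L, ∃ v, M v = 0 ∧ N v ≠ 0 ∧
      ∃ y, N y ∉ LinearMap.range M := by
    push Not at hb hc
    obtain ⟨N₁, h₁, v, hv, hv0⟩ := hb
    obtain ⟨N₂, h₂, y, hy⟩ := hc
    by_cases h3 : N₁ y ∈ LinearMap.range M
    · by_cases h4 : N₂ v = 0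
      · refine ⟨N₁ + N₂, Submodule.add_mem _ h₁ h₂, v, hv, by simpa [h4], y, fun h => hy ?_⟩
        rw [LinearMap.add_apply] at h
        exact (Submodule.add_mem_iff_right _ h3).1 h
      · exact ⟨N₂, h₂, v, hv, h4, y, hy⟩
    · exact ⟨N₁, h₁, v, hv, hv0, y, h3⟩
  -- If M d were off the line of N v₀ = M d₀, then V = ker M + ⟨d₀, d⟩, and N would map all of V
  -- into im M.
  have line : ∀ N ∈ pencil A L, ∀ v₀, M v₀ = 0 → N v₀ ≠ 0 → ∀ y, N y ∉ LinearMap.range M →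
      ∀ d, N d ∈ LinearMap.range M → ∃ c : K, M d = c • N v₀ := by
    intro N hN v₀ hv₀ hβ y hy d hd
    by_contra! hcon
    obtain ⟨d₀, hd₀⟩ := chain0 N hN v₀ hv₀
    obtain ⟨a, b, hab⟩ := plane (chain0 N hN v₀ hv₀) ⟨d, rfl⟩ ⟨y, rfl⟩ hβ hcon
    have h1 : M (y - a • d₀ - b • d) = 0 := by simp [hab, hd₀]
    have h2 := chain0 N hN _ h1
    apply hy
    have h3 : N y = N (y - a • d₀ - b • d) + a • N d₀ + b • N d := by
      simp only [map_sub, map_smul]; abel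
    rw [h3]
    exact Submodule.add_mem _ (Submodule.add_mem _ h2
      (Submodule.smul_mem _ _ (chain1 N hN v₀ d₀ hv₀ hd₀))) (Submodule.smul_mem _ _ hd)
  have kerline : ∀ v, M v = 0 → ∃ c : K, N v = c • N v₀ := by
    intro v hv
    obtain ⟨d, hd⟩ := chain0 N hN v hv
    rw [← hd]
    exact line N hN v₀ hv₀ hβ y₀ hy₀ d (chain1 N hN v d hv hd)
  -- In the positive case every element maps the hyperplane M⁻¹(K · N v₀) into the line K · N v₀.
  by_cases hC : ∀ N' ∈ pencil A L, ∀ v, M v = 0 → ∃ c : K, N' v = c • N v₀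
  · have hgood : ∀ N' ∈ pencil A L, N' v₀ ≠ 0 → (∃ y, N' y ∉ LinearMap.range M) →
        ∀ d, (∃ c : K, M d = c • N v₀) → ∃ c : K, N' d = c • N v₀ := by
      rintro N' hN' h0 ⟨y, hy⟩ d ⟨c, hd⟩
      obtain ⟨c', hc'⟩ := hC N' hN' v₀ hv₀
      have hc'0 : c' ≠ 0 := by rintro rfl; simp [hc'] at h0
      have hd' : M d = N' ((c * c'⁻¹) • v₀) := by
        rw [map_smul, hc', smul_smul, hd, mul_assoc, inv_mul_cancel₀ hc'0, mul_one]
      have hk : M ((c * c'⁻¹) • v₀) = 0 := by rw [map_smul, hv₀, smul_zero]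
      obtain ⟨x, hx⟩ := chain1 N' hN' _ d hk hd'
      obtain ⟨a, ha⟩ := line N' hN' v₀ hv₀ h0 y hy x (chain N' hN' _ d x hk hd' hx)
      exact ⟨a * c', by rw [← hx, ha, hc', smul_smul]⟩
    refine exists_common_kernel_of_hyperplane hsymm hnil
      (U := (Submodule.span K {N v₀}).comap M) (e := N v₀) ?_ hβ ?_
    · intro y hy x
      have hy' : ∀ c : K, M y ≠ c • N v₀ := fun c hc =>
        hy (Submodule.mem_span_singleton.2 ⟨c, hc.symm⟩)
      obtain ⟨a, b, hab⟩ := plane (chain0 N hN v₀ hv₀) ⟨y, rfl⟩ ⟨x, rfl⟩ hβ hy'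
      exact ⟨b, Submodule.mem_span_singleton.2 ⟨a, by simp [hab]⟩⟩
    · intro N' hN' d hd
      have hd' : ∃ c : K, M d = c • N v₀ := by
        obtain ⟨c, hc⟩ := Submodule.mem_span_singleton.1 (Submodule.mem_comap.1 hd)
        exact ⟨c, hc.symm⟩
      -- Each condition fails for at most one s. The claim for N' follows from those for N' + s N
      -- and N.
      obtain ⟨s, hs1, hs2⟩ : ∃ s : K, (N' + s • N) v₀ ≠ 0 ∧
          (N' + s • N) y₀ ∉ LinearMap.range M := by
        by_contra! hcon
        have hf1 : {s : K | (N' + s • N) v₀ = 0}.Subsingleton := by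
          intro s hs t ht
          simp only [Set.mem_ofPred_eq, LinearMap.add_apply, LinearMap.smul_apply] at hs ht
          by_contra hst
          have : (s - t) • N v₀ = 0 := by
            rw [sub_smul, sub_eq_zero]; exact add_left_cancel (hs.trans ht.symm)
          exact (smul_ne_zero (sub_ne_zero.2 hst) hβ) this
        have hf2 : {s : K | (N' + s • N) y₀ ∈ LinearMap.range M}.Subsingleton := by
          intro s hs t ht
          by_contra hst
          have h := Submodule.sub_mem (LinearMap.range M) (show _ ∈ LinearMap.range M from hs)
            (show _ ∈ LinearMap.range M from ht)
          have h' : (N' + s • N) y₀ - (N' + t • N) y₀ = (s - t) • N y₀ := by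
            simp [sub_smul]
          rw [h'] at h
          exact hy₀ ((Submodule.smul_mem_iff _ (sub_ne_zero.2 hst)).1 h)
        refine Set.infinite_univ (α := K) ((hf1.finite.union hf2.finite).subset fun s _ => ?_)
        by_cases h : (N' + s • N) v₀ = 0
        · exact Or.inl h
        · exact Or.inr (hcon s h)
      obtain ⟨c₁, h₁⟩ := hgood _ (Submodule.add_mem _ hN' (Submodule.smul_mem _ s hN)) hs1
        ⟨y₀, hs2⟩ d hd'
      obtain ⟨c₂, h₂⟩ := hgood N hN hβ ⟨y₀, hy₀⟩ d hd'
      refine ⟨c₁ - s * c₂, ?_⟩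
      rw [sub_smul, ← h₁, mul_smul, ← h₂]
      simp
  push Not at hC
  obtain ⟨N', hN', v', hv', hN'v'⟩ := hC
  -- Since N v = 0, the chains of N + N'' and N'' share the same d, so N d ∈ im M.
  have hline : ∀ N'' ∈ pencil A L, ∀ v, M v = 0 → N v = 0 → ∃ c : K, N'' v = c • N v₀ := by
    intro N'' hN'' v hv hNv
    obtain ⟨d, hd⟩ := chain0 N'' hN'' v hv
    have h := chain1 (N + N'') (Submodule.add_mem _ hN hN'') v d hv (by simp [hNv, hd])
    have h' := chain1 N'' hN'' v d hv hd
    rw [LinearMap.add_apply] at h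
    rw [← hd]
    exact line N hN v₀ hv₀ hβ y₀ hy₀ d ((Submodule.add_mem_iff_left _ h').1 h)
  have hfull : ∀ N₁ ∈ pencil A L, ∀ u w, M u = 0 → M w = 0 → N₁ u ≠ 0 →
      (∀ c : K, N₁ w ≠ c • N₁ u) → ∀ y, N₁ y ∈ LinearMap.range M := by
    intro N₁ hN₁ u w hu hw hu0 hwu y
    by_contra hy
    obtain ⟨d, hd⟩ := chain0 N₁ hN₁ w hw
    obtain ⟨c, hc⟩ := line N₁ hN₁ u hu hu0 y hy d (chain1 N₁ hN₁ w d hw hd)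
    exact hwu c (hd ▸ hc)
  -- If N'' v ≠ 0, then N'' and N'' + N both map ker M onto a space of dimension at least 2, so both
  -- have range in im M; hence so has N, contradicting y₀.
  have hkill : ∀ N'' ∈ pencil A L, (∀ c : K, N'' v' ≠ c • N v₀) → ∀ v, M v = 0 → N v = 0 →
      N'' v = 0 := by
    intro N'' hN'' hne v hv hNv
    by_contra hv0
    obtain ⟨c, hc⟩ := hline N'' hN'' v hv hNv
    obtain ⟨b, hb'⟩ := kerline v' hv'
    have h1 := hfull N'' hN'' v v' hv hv' hv0 (fun a ha => hne (a * c) (by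
      rw [ha, hc, smul_smul])) y₀
    have h2 := hfull (N'' + N) (Submodule.add_mem _ hN'' hN) v v' hv hv' (by simpa [hNv])
      (fun a ha => hne (a * c - b) (by
        rw [LinearMap.add_apply, LinearMap.add_apply, hNv, add_zero, hc, hb'] at ha
        rw [sub_smul, mul_smul, ← ha]; simp)) y₀
    rw [LinearMap.add_apply] at h2
    exact hy₀ ((Submodule.add_mem_iff_right _ h1).1 h2)
  have hkill' : ∀ v, M v = 0 → N v = 0 → ∀ N'' ∈ pencil A L, N'' v = 0 := by
    intro v hv hNv N'' hN''
    by_cases h : ∀ c : K, N'' v' ≠ c • N v₀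
    · exact hkill N'' hN'' h v hv hNv
    · push Not at h
      obtain ⟨c, hc⟩ := h
      have := hkill (N'' + N') (Submodule.add_mem _ hN'' hN') (fun a ha => hN'v' (a - c) (by
        rw [sub_smul, ← ha, ← hc]; simp)) v hv hNv
      rwa [LinearMap.add_apply, hkill N' hN' hN'v' v hv hNv, add_zero] at this
  by_cases hk : ∃ v, M v = 0 ∧ N v = 0 ∧ v ≠ 0
  · obtain ⟨v, hv, hNv, hv0⟩ := hk
    exact ⟨v, hv0, hkill' v hv hNv⟩
  -- Now N embeds ker M into a line, so dim V = 2 + 1.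
  push Not at hk
  have hker1 : finrank K (LinearMap.ker M) ≤ 1 := by
    refine finrank_le_one ⟨v₀, hv₀⟩ fun v => ?_
    obtain ⟨c, hc⟩ := kerline v v.2
    refine ⟨c, Subtype.ext (sub_eq_zero.1 (hk (c • v₀ - v) ?_ ?_))⟩
    · simp [hv₀]
    · simp [hc]
  have hker0 : 0 < finrank K (LinearMap.ker M) :=
    finrank_pos_iff_exists_ne_zero.2 ⟨⟨v₁, hv₁⟩, fun h => hv₁0 (congrArg Subtype.val h)⟩
  have := M.finrank_range_add_finrank_ker
  exact exists_common_kernel_of_finrank_eq_three (by omega) hsymm hnil hM hM2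

open Module in
/-- A symmetric nilpotent pencil of rank at most two has a common kernel vector. -/
theorem exists_common_kernel {K V : Type*} [Field K] [Infinite K]
    [AddCommGroup V] [Module K V] [FiniteDimensional K V] [Nontrivial V]
    {A : End K V} {L : V →ₗ[K] End K V}
    (hsymm : ∀ x y, L x y = L y x) (hnil : ∀ N ∈ pencil A L, IsNilpotent N)
    (hrank : ∀ N ∈ pencil A L, finrank K (LinearMap.range N) ≤ 2) :
    ∃ v ≠ 0, ∀ N ∈ pencil A L, N v = 0 := by
  by_cases h2 : ∃ M ∈ pencil A L, finrank K (LinearMap.range M) = 2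
  · obtain ⟨M, hM, hM2⟩ := h2
    exact exists_common_kernel_of_rank_two hsymm hnil hM hM2 hrank
  have hrank1 : ∀ N ∈ pencil A L, finrank K (LinearMap.range N) ≤ 1 := fun N hN => by
    have := hrank N hN
    have : finrank K (LinearMap.range N) ≠ 2 := fun h => h2 ⟨N, hN, h⟩
    omega
  by_cases h1 : ∃ M ∈ pencil A L, M ≠ 0
  · obtain ⟨M, hM, hM0⟩ := h1
    obtain ⟨x, hx⟩ : ∃ x, M x ≠ 0 := by
      by_contra! h
      exact hM0 (LinearMap.ext h)
    have hM1 : 0 < finrank K (LinearMap.range M) := finrank_pos_iff_exists_ne_zero.2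
      ⟨⟨M x, x, rfl⟩, fun h => hx (congrArg Subtype.val h)⟩
    -- In maximal rank 1, ker M is a hyperplane, and the chain argument sends it into the line im M.
    refine exists_common_kernel_of_hyperplane hsymm hnil (U := LinearMap.ker M) (e := M x)
      (fun y hy z => ?_) hx (fun N hN v hv => ?_)
    · obtain ⟨c, hc⟩ := exists_eq_smul_of_finrank_le_one (hrank1 M hM) ⟨y, rfl⟩ ⟨z, rfl⟩ hy
      exact ⟨c, by simp [hc]⟩
    · refine exists_eq_smul_of_finrank_le_one (hrank1 M hM) ⟨x, rfl⟩ ?_ hx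
      refine apply_mem_range_of_chain (v₀ := 0) (v₁ := 0) (fun t => ?_) (map_zero M) (by simp)
        (by simpa using hv)
      have := hrank1 _ (Submodule.add_mem _ hM (Submodule.smul_mem _ t hN))
      omega
  · push Not at h1
    obtain ⟨v, hv⟩ := exists_ne (0 : V)
    exact ⟨v, hv, fun N hN => by simp [h1 N hN]⟩

/-! ### From common kernels to strict triangularity -/

open Module in
/-- Long products of elements of a symmetric nilpotent pencil of rank at most two vanish. -/
theorem exists_forall_prod_eq_zero {K : Type*} [Field K] [Infinite K] (d : ℕ) :
    ∀ {V : Type*} [AddCommGroup V] [Module K V] [FiniteDimensional K V]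
    {A : End K V} {L : V →ₗ[K] End K V}, finrank K V = d →
    (∀ x y, L x y = L y x) → (∀ N ∈ pencil A L, IsNilpotent N) →
    (∀ N ∈ pencil A L, finrank K (LinearMap.range N) ≤ 2) →
    ∀ l : List (End K V), (∀ N ∈ l, N ∈ pencil A L) → l.length = d → l.prod = 0 := by
  induction d with
  | zero =>
    intro V _ _ _ A L hd _ _ _ l _ _
    have := finrank_zero_iff.1 hd
    exact LinearMap.ext fun x => Subsingleton.elim _ _
  | succ d ih =>
    intro V _ _ _ A L hd hsymm hnil hrank l hl hlen
    have : Nontrivial V := nontrivial_of_finrank_pos (R := K) (by omega)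
    obtain ⟨v, hv0, hv⟩ := exists_common_kernel hsymm hnil hrank
    let p := Submodule.span K {v}
    have hle : ∀ N ∈ pencil A L, p ≤ p.comap N := by
      intro N hN
      rw [Submodule.span_singleton_le_iff_mem, Submodule.mem_comap, hv N hN]
      exact p.zero_mem
    let A' : End K (V ⧸ p) := p.mapQ p A (hle A (mem_pencil_left A L))
    let G : V →ₗ[K] End K (V ⧸ p) :=
      { toFun x := p.mapQ p (L x) (hle _ (mem_pencil_right A L x))
        map_add' x y := by ext z; simp
        map_smul' c x := by ext z; simp }
    have hG (x y : V) : G x (p.mkQ y) = p.mkQ (L x y) := rfl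
    -- Well defined by symmetry: L v y = L y v = 0.
    let L' : (V ⧸ p) →ₗ[K] End K (V ⧸ p) := p.liftQ G (by
      rw [Submodule.span_singleton_le_iff_mem, LinearMap.mem_ker]
      ext y
      change p.mkQ (L v y) = 0
      rw [hsymm, hv _ (mem_pencil_right A L y), map_zero])
    have hL' (x y : V) : L' (p.mkQ x) (p.mkQ y) = p.mkQ (L x y) := rfl
    have hA' (y : V) : A' (p.mkQ y) = p.mkQ (A y) := rfl
    have hdown : ∀ N ∈ pencil A L, ∃ N' ∈ pencil A' L', ∀ y, N' (p.mkQ y) = p.mkQ (N y) := by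
      intro N hN
      obtain ⟨s, x, rfl⟩ := mem_pencil.1 hN
      exact ⟨s • A' + L' (p.mkQ x), mem_pencil.2 ⟨s, _, rfl⟩, fun y => by
        simp only [LinearMap.add_apply, LinearMap.smul_apply, hL', hA', map_add, map_smul]⟩
    have hup : ∀ N' ∈ pencil A' L', ∃ N ∈ pencil A L, ∀ y, N' (p.mkQ y) = p.mkQ (N y) := by
      intro N hN
      obtain ⟨s, x, rfl⟩ := mem_pencil.1 hN
      obtain ⟨x, rfl⟩ := p.mkQ_surjective x
      exact ⟨s • A + L x, mem_pencil.2 ⟨s, _, rfl⟩, fun y => by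
        simp only [LinearMap.add_apply, LinearMap.smul_apply, hL', hA', map_add, map_smul]⟩
    have hd' : finrank K (V ⧸ p) = d := by
      have h1 := p.finrank_quotient_add_finrank
      have h2 : finrank K p = 1 := finrank_span_singleton hv0
      omega
    have hsymm' : ∀ x y, L' x y = L' y x := by
      intro x y
      obtain ⟨x, rfl⟩ := p.mkQ_surjective x
      obtain ⟨y, rfl⟩ := p.mkQ_surjective y
      rw [hL', hL', hsymm]
    have hnil' : ∀ N ∈ pencil A' L', IsNilpotent N := by
      intro N' hN'
      obtain ⟨N, hN, h⟩ := hup N' hN'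
      obtain ⟨k, hk⟩ := hnil N hN
      have hpow : ∀ (k : ℕ) (y), (N' ^ k) (p.mkQ y) = p.mkQ ((N ^ k) y) := by
        intro k
        induction k with
        | zero => intro y; rfl
        | succ k ih => intro y; rw [pow_succ, pow_succ, End.mul_apply, End.mul_apply, h, ih]
      refine ⟨k, LinearMap.ext fun x => ?_⟩
      obtain ⟨x, rfl⟩ := p.mkQ_surjective x
      rw [hpow, hk]; simp
    have hrank' : ∀ N ∈ pencil A' L', finrank K (LinearMap.range N) ≤ 2 := by
      intro N' hN'
      obtain ⟨N, hN, h⟩ := hup N' hN'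
      have : LinearMap.range N' ≤ (LinearMap.range N).map p.mkQ := by
        rintro _ ⟨x, rfl⟩
        obtain ⟨x, rfl⟩ := p.mkQ_surjective x
        exact ⟨N x, ⟨x, rfl⟩, (h x).symm⟩
      exact (Submodule.finrank_mono this).trans ((Submodule.finrank_map_le _ _).trans (hrank N hN))
    have hlist : ∀ l : List (End K V), (∀ N ∈ l, N ∈ pencil A L) →
        ∃ l' : List (End K (V ⧸ p)), (∀ N ∈ l', N ∈ pencil A' L') ∧ l'.length = l.length ∧
          ∀ y, l'.prod (p.mkQ y) = p.mkQ (l.prod y) := by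
      intro l
      induction l with
      | nil => exact fun _ => ⟨[], by simp, rfl, fun y => rfl⟩
      | cons N l ihl =>
        intro hl
        obtain ⟨l', h1, h2, h3⟩ := ihl fun N hN => hl N (List.mem_cons_of_mem _ hN)
        obtain ⟨N', hN', h4⟩ := hdown N (hl N List.mem_cons_self)
        refine ⟨N' :: l', List.forall_mem_cons.2 ⟨hN', h1⟩, by simp [h2], fun y => ?_⟩
        rw [List.prod_cons, List.prod_cons, End.mul_apply, h3, h4, End.mul_apply]
    rcases l with _ | ⟨N, l⟩
    · simp at hlen
    obtain ⟨l', h1, h2, h3⟩ := hlist l fun N hN => hl N (List.mem_cons_of_mem _ hN)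
    have h4 := ih hd' hsymm' hnil' hrank' l' h1 (by simpa [h2] using hlen)
    ext y
    -- The tail of the product maps into the line of v, which the head kills.
    have h5 : p.mkQ (l.prod y) = 0 := by rw [← h3, h4]; rfl
    rw [Submodule.mkQ_apply, Submodule.Quotient.mk_eq_zero] at h5
    obtain ⟨c, hc⟩ := Submodule.mem_span_singleton.1 h5
    rw [List.prod_cons, End.mul_apply, ← hc, map_smul, hv N (hl N List.mem_cons_self), smul_zero,
      LinearMap.zero_apply]

open Module in
/-- A family of endomorphisms whose long products vanish is strictly triangular with respect to
some basis. -/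
theorem exists_basis_strictly_lower_triangular {K ι : Type*} [Field K] (d : ℕ) :
    ∀ {V : Type*} [AddCommGroup V] [Module K V] [FiniteDimensional K V] {m : ℕ}
    (f : ι → End K V), finrank K V = d → (∀ l : List ι, l.length = m → (l.map f).prod = 0) →
    ∃ b : Basis (Fin d) K V, ∀ a i j, i ≤ j → b.repr (f a (b j)) i = 0 := by
  induction d with
  | zero =>
    intro V _ _ _ m f hd _
    exact ⟨finBasisOfFinrankEq K V hd, fun a i => i.elim0⟩
  | succ d ih =>
    intro V _ _ _ m f hd hf
    let S : Submodule K V := ⨆ a, LinearMap.range (f a)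
    -- If the ranges spanned V, rightmost factors could be cancelled from the vanishing products
    -- until the empty product 1 vanished.
    have hS : S < ⊤ := by
      rw [lt_top_iff_ne_top]
      intro htop
      have hall : ∀ k : ℕ, k ≤ m → ∀ l : List ι, l.length = m - k → (l.map f).prod = 0 := by
        intro k
        induction k with
        | zero => intro _ l hl; exact hf l hl
        | succ k ihk =>
          intro hk l hl
          have hker : S ≤ LinearMap.ker (l.map f).prod := by
            refine iSup_le fun a => ?_
            rintro _ ⟨x, rfl⟩
            have := ihk (by omega) (l ++ [a]) (by simp; omega)
            rw [List.map_append, List.prod_append] at this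
            simpa using LinearMap.congr_fun this x
          rw [htop, top_le_iff, LinearMap.ker_eq_top] at hker
          exact hker
      have h1 := hall m le_rfl [] (by simp)
      have : Nontrivial V := nontrivial_of_finrank_pos (R := K) (by omega)
      obtain ⟨v, hv⟩ := exists_ne (0 : V)
      exact hv (by simpa using LinearMap.congr_fun h1 v)
    obtain ⟨φ, hφ0, hφ⟩ := Submodule.exists_le_ker_of_lt_top S hS
    obtain ⟨y, hy⟩ : ∃ y, φ y ≠ 0 := by
      by_contra! h
      exact hφ0 (LinearMap.ext h)
    let U := LinearMap.ker φ
    have hU (a : ι) (x : V) : f a x ∈ U := hφ (Submodule.mem_iSup_of_mem a ⟨x, rfl⟩)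
    have hUd : finrank K U = d := by
      have h1 := φ.finrank_range_add_finrank_ker
      have h2 : LinearMap.range φ = ⊤ := LinearMap.range_eq_top.2
        (LinearMap.surjective_of_ne_zero hφ0)
      rw [h2, finrank_top, finrank_self, hd] at h1
      change finrank K (LinearMap.ker φ) = d
      omega
    let g (a : ι) : End K U := (f a).restrict fun x _ => hU a x
    have hg (l : List ι) (x : U) : (((l.map g).prod x : U) : V) = (l.map f).prod x := by
      induction l with
      | nil => rfl
      | cons a l ihl =>
        rw [List.map_cons, List.map_cons, List.prod_cons, List.prod_cons, End.mul_apply,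
          End.mul_apply, ← ihl]
        rfl
    obtain ⟨b, hb⟩ := ih g hUd fun l hl => LinearMap.ext fun x => Subtype.ext (by
      rw [hg, hf l hl]; rfl)
    let b' : Basis (Fin (d + 1)) K V := Basis.mkFinCons y b
      (by
        intro c x hx h
        have h1 := congrArg φ h
        rw [map_add, map_smul, LinearMap.mem_ker.1 hx, add_zero, map_zero, smul_eq_mul] at h1
        exact (mul_eq_zero.1 h1).resolve_right hy)
      (by
        intro z
        refine ⟨-(φ z / φ y), ?_⟩
        rw [LinearMap.mem_ker, map_add, map_smul, smul_eq_mul]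
        field_simp
        ring)
    have hb'0 : b' 0 = y := by simp [b']
    have hb's (i : Fin d) : b' i.succ = b i := by simp [b']
    have hrepr (x : U) (i : Fin (d + 1)) :
        b'.repr x i = Fin.cases 0 (fun i => b.repr x i) i := by
      have hx : (x : V) = ∑ i, (Fin.cons 0 (b.repr x) : Fin (d + 1) → K) i • b' i := by
        rw [Fin.sum_univ_succ]
        simp only [Fin.cons_zero, zero_smul, zero_add, Fin.cons_succ, hb's]
        have h1 := congrArg Subtype.val (b.sum_repr x)
        rw [Submodule.coe_sum] at h1
        exact h1.symm
      rw [hx, b'.repr_sum_self]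
      refine Fin.cases ?_ (fun i => ?_) i <;> simp
    refine ⟨b', fun a i j hij => ?_⟩
    have := hrepr ⟨f a (b' j), hU a _⟩ i
    rw [this]
    induction i using Fin.cases with
    | zero => rfl
    | succ i =>
      induction j using Fin.cases with
      | zero => simp at hij
      | succ j =>
        have h1 := hb a i j (Fin.succ_le_succ_iff.1 hij)
        have h2 : (⟨f a (b' j.succ), hU a _⟩ : U) = g a (b j) := Subtype.ext (by
          rw [hb's]; rfl)
        rw [h2]
        exact h1

/-! ### Minors and rank under specialisation -/

theorem Matrix.exists_submatrix_rows_linearIndependent {K : Type*} [Field K] {m n : Type*}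
    [Fintype m] [Fintype n] (A : Matrix m n K) {k : ℕ} (hk : A.rank = k) :
    ∃ r : Fin k → m, LinearIndependent K (A.submatrix r id).row := by
  rw [Matrix.rank_eq_finrank_span_row] at hk
  subst hk
  obtain ⟨f, hf, -, hli⟩ := Submodule.exists_fun_fin_finrank_span_eq K (Set.range A.row)
  choose r hr using hf
  refine ⟨r, ?_⟩
  have h : (A.submatrix r id).row = f := funext hr
  rwa [h]

/-- A matrix of rank `k` has a nonzero minor of size `k`. -/
theorem Matrix.exists_submatrix_det_ne_zero {K : Type*} [Field K] {m n : Type*} [Fintype m]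
    [Fintype n] (A : Matrix m n K) {k : ℕ} (hk : A.rank = k) :
    ∃ (r : Fin k → m) (c : Fin k → n), (A.submatrix r c).det ≠ 0 := by
  obtain ⟨r, hr⟩ := A.exists_submatrix_rows_linearIndependent hk
  have h1 : (A.submatrix r id).transpose.rank = k := by
    rw [Matrix.rank_transpose, hr.rank_matrix, Fintype.card_fin]
  obtain ⟨c, hc⟩ := (A.submatrix r id).transpose.exists_submatrix_rows_linearIndependent h1
  refine ⟨r, c, ?_⟩
  rw [Matrix.linearIndependent_rows_iff_isUnit, Matrix.isUnit_iff_isUnit_det] at hc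
  rw [← Matrix.det_transpose]
  exact hc.ne_zero

/-- The rank of a matrix does not increase under a ring homomorphism from a domain to a field. -/
theorem Matrix.rank_map_le_rank_fractionRing {R F : Type*} [CommRing R] [IsDomain R] [Field F]
    (φ : R →+* F) {m n : Type*} [Fintype m] [Fintype n] (M : Matrix m n R) :
    (M.map φ).rank ≤ (M.map (algebraMap R (FractionRing R))).rank := by
  obtain ⟨r, c, h⟩ := (M.map φ).exists_submatrix_det_ne_zero rfl
  generalize (M.map φ).rank = k at r c h
  have h1 : (M.submatrix r c).det ≠ 0 := by
    intro h0
    apply h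
    rw [Matrix.submatrix_map, ← RingHom.mapMatrix_apply, ← RingHom.map_det, h0, map_zero]
  have h2 : ((M.map (algebraMap R (FractionRing R))).submatrix r c).det ≠ 0 := by
    rw [Matrix.submatrix_map, ← RingHom.mapMatrix_apply, ← RingHom.map_det]
    exact fun h => h1 ((injective_iff_map_eq_zero _).1
      (IsFractionRing.injective R (FractionRing R)) _ h)
  have h3 := Matrix.rank_of_det_ne_zero h2
  rw [Fintype.card_fin] at h3
  rw [← h3]
  exact Matrix.rank_submatrix_le _ _ _

/-! ### The pencil of a quadratic Jacobian matrix -/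

/-- A polynomial with all coefficients in degree at least two zero is affine linear. -/
theorem MvPolynomial.eq_affine_of_coeff {K : Type*} [CommRing K] {n : ℕ}
    {q : MvPolynomial (Fin n) K} (hq : ∀ m : Fin n →₀ ℕ, 2 ≤ m.degree → q.coeff m = 0) :
    q = C (q.coeff 0) + ∑ k, X k * C (q.coeff (Finsupp.single k 1)) := by
  classical
  ext m
  simp only [coeff_add, coeff_C, coeff_sum, mul_comm (X _), coeff_C_mul, coeff_X]
  by_cases h0 : m = 0
  · subst h0
    simp
  by_cases h1 : ∃ k, m = Finsupp.single k 1
  · obtain ⟨k, rfl⟩ := h1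
    simp [Finsupp.single_left_inj, eq_comm]
  push Not at h1
  rw [hq, if_neg (Ne.symm h0), zero_add, Finset.sum_eq_zero]
  · intro k _
    rw [if_neg (Ne.symm (h1 k)), mul_zero]
  · by_contra! h2
    obtain ⟨k, hk⟩ : ∃ k, m k ≠ 0 := by
      by_contra! h; exact h0 (Finsupp.ext h)
    have h3 : m = (m - Finsupp.single k 1) + Finsupp.single k 1 := by
      rw [tsub_add_cancel_of_le]
      exact Finsupp.single_le_iff.2 (Nat.one_le_iff_ne_zero.2 hk)
    have h4 : (m - Finsupp.single k 1).degree = 0 := by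
      have := congrArg Finsupp.degree h3
      rw [map_add, Finsupp.degree_single] at this
      omega
    rw [Finsupp.degree_eq_zero_iff] at h4
    rw [h4, zero_add] at h3
    exact h1 k h3

/-- The coefficient matrices of the Jacobian matrix of a quadratic map: `none` is the constant
part, `some k` the coefficient of `x k`. -/
noncomputable def jacobianCoeff {K : Type*} [Field K] {n : ℕ}
    (H : Fin n → MvPolynomial (Fin n) K) (o : Option (Fin n)) : Matrix (Fin n) (Fin n) K :=
  Matrix.of fun i j => (MvPolynomial.pderiv j (H i)).coeff (o.elim 0 fun k => Finsupp.single k 1)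

/-- Partial derivatives commute. This supplies the symmetry of the pencil, in every characteristic.
-/
theorem jacobianCoeff_symm {K : Type*} [Field K] {n : ℕ}
    (H : Fin n → MvPolynomial (Fin n) K) (i j k : Fin n) :
    jacobianCoeff H (some k) i j = jacobianCoeff H (some j) i k := by
  classical
  simp only [jacobianCoeff, Matrix.of_apply, Option.elim_some, MvPolynomial.coeff_pderiv,
    Finsupp.single_apply]
  rw [add_comm]
  simp only [eq_comm]

theorem jacobianMatrix_eq {K : Type*} [Field K] {n : ℕ} {H : Fin n → MvPolynomial (Fin n) K}
    (hH : IsQuadraticMap H) : jacobianMatrix H = (jacobianCoeff H none).map MvPolynomial.C +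
      ∑ k, (MvPolynomial.X k : MvPolynomial (Fin n) K) •
        (jacobianCoeff H (some k)).map MvPolynomial.C := by
  ext1 i j
  rw [Matrix.add_apply, Matrix.sum_apply]
  refine MvPolynomial.eq_affine_of_coeff fun m hm => ?_
  change (MvPolynomial.pderiv j (H i)).coeff m = 0
  rw [MvPolynomial.coeff_pderiv, MvPolynomial.coeff_eq_zero_of_totalDegree_lt, zero_mul]
  refine (hH i).trans_lt ?_
  change 2 < (m + Finsupp.single j 1).degree
  rw [map_add, Finsupp.degree_single]
  omega

open Module in
/-- The elements of the pencil of a nilpotent quadratic Jacobian matrix over an extension field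
are nilpotent, and their rank is at most that of the Jacobian matrix. -/
theorem jacobian_pencil_isNilpotent_and_rank_le {K E : Type*} [Field K] [Field E] [Algebra K E]
    {n : ℕ} {H : Fin n → MvPolynomial (Fin n) K} (hquad : IsQuadraticMap H)
    (hnil : IsNilpotent (jacobianMatrix H)) (s : E) (x : Fin n → E) :
    let N := s • (jacobianCoeff H none).map (algebraMap K E) +
      ∑ k, x k • (jacobianCoeff H (some k)).map (algebraMap K E)
    IsNilpotent N ∧ N.rank ≤ polyRank (jacobianMatrix H) := by
  intro N
  let F := FractionRing (Polynomial E)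
  let j : Polynomial E →+* F := algebraMap (Polynomial E) F
  have hj : Function.Injective j := IsFractionRing.injective (Polynomial E) F
  have hT : j Polynomial.X ≠ 0 := (map_ne_zero_iff j hj).2 Polynomial.X_ne_zero
  -- Homogenisation: over E(T), P = T · JH(x / T), which inherits nilpotency and the rank bound. Its
  -- entries are polynomials in T, so T can be specialised to any s, including 0.
  let P : Matrix (Fin n) (Fin n) (Polynomial E) :=
    (Polynomial.X : Polynomial E) •
      (jacobianCoeff H none).map (Polynomial.C.comp (algebraMap K E)) +
    ∑ k, Polynomial.C (x k) •
      (jacobianCoeff H (some k)).map (Polynomial.C.comp (algebraMap K E))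
  let ψ : MvPolynomial (Fin n) K →+* F :=
    MvPolynomial.eval₂Hom (j.comp (Polynomial.C.comp (algebraMap K E)))
      fun k => j (Polynomial.C (x k)) / j Polynomial.X
  have hP : P.map j = j Polynomial.X • (jacobianMatrix H).map ψ := by
    rw [jacobianMatrix_eq hquad]
    ext i l
    simp only [P, ψ, Matrix.map_apply, Matrix.add_apply, Matrix.smul_apply, Matrix.sum_apply,
      smul_eq_mul, map_add, map_mul, map_sum, MvPolynomial.coe_eval₂Hom, MvPolynomial.eval₂_X,
      MvPolynomial.eval₂_C, MvPolynomial.eval₂_add, MvPolynomial.eval₂_mul,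
      MvPolynomial.eval₂_sum, RingHom.comp_apply, mul_add, Finset.mul_sum]
    congr 1
    refine Finset.sum_congr rfl fun k _ => ?_
    rw [← mul_assoc, mul_div_cancel₀ _ hT]
  have hN : P.map (Polynomial.evalRingHom s) = N := by
    ext i l
    simp [P, N, Matrix.sum_apply, Polynomial.eval_finsetSum, mul_comm s]
  have hPnil : IsNilpotent P := by
    have h1 : IsNilpotent (j.mapMatrix P) := by
      rw [RingHom.mapMatrix_apply, hP]
      exact (hnil.map ψ.mapMatrix).smul _
    exact (IsNilpotent.map_iff (f := j.mapMatrix) (Matrix.map_injective hj)).1 h1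
  have hPrank : (P.map j).rank ≤ polyRank (jacobianMatrix H) := by
    rw [hP, Matrix.rank_smul_of_mem_nonZeroDivisors _ (mem_nonZeroDivisors_of_ne_zero hT)]
    exact Matrix.rank_map_le_rank_fractionRing ψ _
  rw [← hN]
  exact ⟨hPnil.map (Polynomial.evalRingHom s).mapMatrix,
    (Matrix.rank_map_le_rank_fractionRing _ P).trans hPrank⟩

open Module in
/-- Products of `n` coefficient matrices of a nilpotent quadratic Jacobian matrix of rank at most
two vanish. -/
theorem jacobianCoeff_prod_eq_zero {K : Type*} (E : Type*) [Field K] [Field E] [Infinite E]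
    [Algebra K E] {n : ℕ}
    {H : Fin n → MvPolynomial (Fin n) K} (hquad : IsQuadraticMap H)
    (hrank : polyRank (jacobianMatrix H) ≤ 2) (hnil : IsNilpotent (jacobianMatrix H))
    (l : List (Option (Fin n))) (hl : l.length = n) :
    (l.map (jacobianCoeff H)).prod = 0 := by
  let e : Matrix (Fin n) (Fin n) E ≃ₐ[E] End E (Fin n → E) := Matrix.toLinAlgEquiv'
  let B (o : Option (Fin n)) : Matrix (Fin n) (Fin n) E :=
    (algebraMap K E).mapMatrix (jacobianCoeff H o)
  let L : (Fin n → E) →ₗ[E] End E (Fin n → E) :=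
    ∑ k, (LinearMap.proj k : (Fin n → E) →ₗ[E] E).smulRight (e (B (some k)))
  have hL (x : Fin n → E) : L x = e (∑ k, x k • B (some k)) := by
    simp [L, LinearMap.sum_apply]
  have hpencil : ∀ N ∈ pencil (e (B none)) L, ∃ (s : E) (x : Fin n → E),
      N = e (s • B none + ∑ k, x k • B (some k)) := by
    intro N hN
    obtain ⟨s, x, rfl⟩ := mem_pencil.1 hN
    exact ⟨s, x, by rw [hL, map_add, map_smul]⟩
  have hsymm : ∀ x y, L x y = L y x := by
    intro x y
    rw [hL, hL]
    ext i
    have happ (N : Matrix (Fin n) (Fin n) E) (z : Fin n → E) : e N z = N.mulVec z := rfl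
    simp only [happ, Matrix.mulVec, dotProduct, Matrix.sum_apply, Matrix.smul_apply, B,
      RingHom.mapMatrix_apply, Matrix.map_apply, smul_eq_mul, Finset.sum_mul]
    rw [Finset.sum_comm]
    refine Finset.sum_congr rfl fun k _ => Finset.sum_congr rfl fun l _ => ?_
    rw [jacobianCoeff_symm]
    ring
  have hprod := exists_forall_prod_eq_zero n (A := e (B none)) (L := L) (by simp) hsymm
    (by
      intro N hN
      obtain ⟨s, x, rfl⟩ := hpencil N hN
      exact (jacobian_pencil_isNilpotent_and_rank_le hquad hnil s x).1.map e)
    (by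
      intro N hN
      obtain ⟨s, x, rfl⟩ := hpencil N hN
      exact (jacobian_pencil_isNilpotent_and_rank_le hquad hnil s x).2.trans hrank)
    (l.map fun o => e (B o))
    (by
      intro N hN
      obtain ⟨o, -, rfl⟩ := List.mem_map.1 hN
      cases o with
      | none => exact mem_pencil_left _ _
      | some k =>
        have : e (B (some k)) = L (Pi.single k 1) := by
          rw [hL, Finset.sum_eq_single k] <;> simp +contextual
        rw [this]
        exact mem_pencil_right _ _ _)
    (by simpa using hl)
  have h1 : e ((algebraMap K E).mapMatrix (l.map (jacobianCoeff H)).prod) = 0 := by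
    rw [← hprod, map_list_prod, map_list_prod, List.map_map, List.map_map]
    rfl
  rw [map_eq_zero_iff e e.injective] at h1
  exact Matrix.map_injective (algebraMap K E).injective (by simpa using h1)

theorem theorem3 {K : Type*} [Field K] {n : ℕ} (H : Fin n → MvPolynomial (Fin n) K)
    (hquad : IsQuadraticMap H)
    (hrank : polyRank (jacobianMatrix H) ≤ 2)
    (hnil : IsNilpotent (jacobianMatrix H)) :
    ∃ M : Matrix (Fin n) (Fin n) (MvPolynomial (Fin n) K),
      SimilarOver K (jacobianMatrix H) M ∧ IsTriangularMatrix M ∧ ∀ i, M i i = 0 := by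
  obtain ⟨b, hb⟩ := exists_basis_strictly_lower_triangular n (m := n)
    (fun o => Matrix.toLinAlgEquiv' (jacobianCoeff H o)) (by simp) (fun l hl => by
      -- The algebraic closure is infinite even when K is finite.
      have h := jacobianCoeff_prod_eq_zero (AlgebraicClosure K) hquad hrank hnil l hl
      have h2 := congrArg (Matrix.toLinAlgEquiv' (R := K) (n := Fin n)) h
      rw [map_list_prod, List.map_map, map_zero] at h2
      exact h2)
  let c := Pi.basisFun K (Fin n)
  let T : Matrix.GeneralLinearGroup (Fin n) K :=
    ⟨c.toMatrix b, b.toMatrix c, c.toMatrix_mul_toMatrix_flip b, b.toMatrix_mul_toMatrix_flip c⟩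
  have hT (o) (i j : Fin n) (hij : i ≤ j) :
      (((T⁻¹ : Matrix.GeneralLinearGroup (Fin n) K) : Matrix (Fin n) (Fin n) K) *
        jacobianCoeff H o * (T : Matrix (Fin n) (Fin n) K)) i j = 0 := by
    have h1 := basis_toMatrix_mul_linearMap_toMatrix_mul_basis_toMatrix b c b c
      (Matrix.toLin' (jacobianCoeff H o))
    have h2 : LinearMap.toMatrix c c (Matrix.toLin' (jacobianCoeff H o)) = jacobianCoeff H o :=
      LinearMap.toMatrix'_toLin' _
    rw [h2] at h1
    change (b.toMatrix c * jacobianCoeff H o * c.toMatrix b) i j = 0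
    rw [h1, LinearMap.toMatrix_apply]
    exact hb o i j hij
  have hzero (i j : Fin n) (hij : i ≤ j) :
      (((T⁻¹ : Matrix.GeneralLinearGroup (Fin n) K) : Matrix (Fin n) (Fin n) K).map
        (algebraMap K (MvPolynomial (Fin n) K)) * jacobianMatrix H *
        (T : Matrix (Fin n) (Fin n) K).map (algebraMap K (MvPolynomial (Fin n) K))) i j = 0 := by
    rw [jacobianMatrix_eq hquad, MvPolynomial.algebraMap_eq]
    simp only [mul_add, add_mul, Finset.mul_sum, Finset.sum_mul, Matrix.mul_smul, Matrix.smul_mul,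
      ← Matrix.map_mul, Matrix.add_apply, Matrix.sum_apply, Matrix.smul_apply, Matrix.map_apply,
      hT _ i j hij, map_zero, smul_zero, Finset.sum_const_zero, add_zero]
  exact ⟨_, ⟨T, rfl⟩, Or.inr fun i j hij => hzero i j (le_of_lt hij), fun i => hzero i i le_rfl⟩
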